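/- Let $n\in\mathbb N$, $f\in\mathbb R^n$, $\sigma\ge 0$, and let $Y=(Y_1,\dots,Y_n)$ have independent coordinates $Y_i\sim\mathcal N(f_i,\sigma^2)$. Let $\{\widehat f_\lambda,\ \lambda\in\Lambda\}$ be an arbitrary collection of estimators, i.e. random vectors of $\mathbb R^n$. Let $\mathbb S$ be a finite or countable family of linear subspaces of $\mathbb R^n$ with $\dim(S)\le n-2$ for all $S\in\mathbb S$, let $\mathbb S_\lambda\subset\mathbb S$ be (possibly random) subsets, and let $\Delta,\mathrm{pen}:\mathbb S\to\mathbb R_+$ be such that $\Sigma=\sum_{S\in\mathbb S}e^{-\Delta(S)}<\infty$. For $S\in\mathbb S$ let $\Pi_S$ be the orthogonal projection onto $S$, $\widehat\sigma_S^2=\|Y-\Pi_SY\|^2/(n-\dim S)$, and let $\mathrm{pen}_\Delta(S)\ge0$ be the solution $x$ of $$\mathbb E\Big[\Big(U-\frac{x}{n-\dim S}V\Big)_+\Big]=e^{-\Delta(S)},$$ where $U,V$ are independent $\chi^2$ variables with $\dim(S)+1$ and $n-\dim(S)-1$ degrees of freedom. Let $K>1$ and assume $\mathrm{pen}(S)\ge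 K\,\mathrm{pen}_\Delta(S)$ for all $S\in\mathbb S$. For $\alpha>0$ set $$\mathrm{crit}_\alpha(\widehat f_\lambda)=\inf_{S\in\mathbb S_\lambda}\big[\|Y-\Pi_S\widehat f_\lambda\|^2+\alpha\|\widehat f_\lambda-\Pi_S\widehat f_\lambda\|^2+\mathrm{pen}(S)\widehat\sigma_S^2\big],$$ $$A(\widehat f_\lambda,\mathbb S_\lambda)=\inf_{S\in\mathbb S_\lambda}\big[\|\widehat f_\lambda-\Pi_S\widehat f_\lambda\|^2+\mathrm{pen}(S)\widehat\sigma_S^2\big].$$ (1) Let $\alpha>0$, $\delta\ge0$ and let $\widehat\lambda$ be a random element of $\Lambda$ with $\mathrm{crit}_\alpha(\widehat f_{\widehat\lambda})\le\inf_{\lambda\in\Lambda}\mathrm{crit}_\alpha(\widehat f_\lambda)+\delta$ almost surely. Then, with the positive constant $$C=C(K,\alpha)=\frac{\alpha(1-K^{-1})}{(1+\alpha-K^{-1})\,\max\{\alpha+2(1+K^{-1}),\,2K\}},$$ one has $$C\,\mathbb E\big[\|f-\widehat f_{\widehat\lambda}\|^2\big]\le\mathbb E\Big[\inf_{\lambda\in\Lambda}\big(\|f-\widehat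 f_\lambda\|^2+A(\widehat f_\lambda,\mathbb S_\lambda)\big)\Big]+\Sigma\sigma^2+\delta$$ $$\le\inf_{\lambda\in\Lambda}\big\{\mathbb E[\|f-\widehat f_\lambda\|^2]+\mathbb E[A(\widehat f_\lambda,\mathbb S_\lambda)]\big\}+\Sigma\sigma^2+\delta .$$ (2) For every $\kappa\in(0,1)$ there is a constant $C'>0$ depending only on $\kappa$ and $K$ such that, if $\mathrm{pen}(S)=K\,\mathrm{pen}_\Delta(S)$ and $1\le\dim(S)\vee\Delta(S)\le\kappa n$ for all $S\in\mathbb S$, then for each $\lambda\in\Lambda$: (a) if $\mathbb S_\lambda$ is non-random, $$C'\,\mathbb E[A(\widehat f_\lambda,\mathbb S_\lambda)]\le\mathbb E[\|f-\widehat f_\lambda\|^2]+\inf_{S\in\mathbb S_\lambda}\Big[\mathbb E[\|\widehat f_\lambda-\Pi_S\widehat f_\lambda\|^2]+(\dim(S)\vee\Delta(S))\sigma^2\Big];$$ (b) if there is a (possibly random) linear space $\widehat S_\lambda\in\mathbb S_\lambda$ with $\widehat f_\lambda\in\widehat S_\lambda$ almost surely, $$C'\,\mathbb E[A(\widehat f_\lambda,\mathbb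 S_\lambda)]\le\mathbb E[\|f-\widehat f_\lambda\|^2]+\mathbb E[\dim(\widehat S_\lambda)\vee\Delta(\widehat S_\lambda)]\,\sigma^2 .$$ Expectations and infima are taken in $[0,\infty]$, with $\inf\varnothing=+\infty$; the expectation of a non-negative function that is not measurable is read as its lower integral. -/

import Mathlib

open MeasureTheory ProbabilityTheory Filter Topology
open scoped NNReal ENNReal

noncomputable section

namespace EstimatorSelection

/-- The Euclidean space `ℝⁿ`. -/
abbrev Vec (n : ℕ) : Type := EuclideanSpace ℝ (Fin n)

/-- The `χ²` distribution with `k` degrees of freedom: the law of the sum of the squares of `k`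
independent standard Gaussian variables. -/
def chiSq (k : ℕ) : Measure ℝ :=
  (Measure.pi fun _ : Fin k => gaussianReal 0 1).map fun z => ∑ i, z i ^ 2

/-- `E[(U - x V / (n - d))₊]` for independent `χ²` variables `U` and `V` with `d + 1` and
`n - d - 1` degrees of freedom. -/
def expectedExcess (n d : ℕ) (x : ℝ) : ℝ :=
  ∫ w : ℝ × ℝ, max (w.1 - x / ((n : ℝ) - d) * w.2) 0
    ∂((chiSq (d + 1)).prod (chiSq (n - d - 1)))

/-- `pen_Δ(S)`: the solution `x ≥ 0` of `E[(U - x V / (n - dim S))₊] = exp (-Δ(S))`. Existence and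
uniqueness of the solution for `dim S ≤ n - 2` are `existsUnique_expectedExcess_eq` below, and
`penDelta_spec` says that `penDelta` is this solution. -/
def penDelta {n : ℕ} (Δ : Submodule ℝ (Vec n) → ℝ≥0) (S : Submodule ℝ (Vec n)) : ℝ :=
  sInf {x : ℝ | 0 ≤ x ∧ expectedExcess n (Module.finrank ℝ S) x = Real.exp (-(Δ S : ℝ))}

/-- The variance estimator `‖y - Π_S y‖² / (n - dim S)`. -/
def sigmaHatSq {n : ℕ} (S : Submodule ℝ (Vec n)) (y : Vec n) : ℝ :=
  ‖y - S.starProjection y‖ ^ 2 / ((n : ℝ) - Module.finrank ℝ S)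

/-- The criterion `crit_α` of the estimate `g` at the observation `y`, for the subfamily `T` of
linear spaces; it is `+∞` if `T` is empty. -/
def crit {n : ℕ} (α : ℝ) (pen : Submodule ℝ (Vec n) → ℝ≥0) (T : Set (Submodule ℝ (Vec n)))
    (y g : Vec n) : ℝ≥0∞ :=
  ⨅ S ∈ T, ENNReal.ofReal
    (‖y - S.starProjection g‖ ^ 2 + α * ‖g - S.starProjection g‖ ^ 2 + pen S * sigmaHatSq S y)

/-- The accuracy index `A(g, T)` of the estimate `g` at the observation `y`, for the subfamily `T`
of linear spaces; it is `+∞` if `T` is empty. -/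
def accuracy {n : ℕ} (pen : Submodule ℝ (Vec n) → ℝ≥0) (T : Set (Submodule ℝ (Vec n)))
    (y g : Vec n) : ℝ≥0∞ :=
  ⨅ S ∈ T, ENNReal.ofReal (‖g - S.starProjection g‖ ^ 2 + pen S * sigmaHatSq S y)

/-- `dim S ∨ Δ(S)`. -/
def complexity {n : ℕ} (Δ : Submodule ℝ (Vec n) → ℝ≥0) (S : Submodule ℝ (Vec n)) : ℝ :=
  max (Module.finrank ℝ S : ℝ) (Δ S)

/-- The constant of the risk bound. -/
def riskConst (K α : ℝ) : ℝ :=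
  α * (1 - K⁻¹) / ((1 + α - K⁻¹) * max (α + 2 * (1 + K⁻¹)) (2 * K))

theorem riskConst_pos {K α : ℝ} (hK : 1 < K) (hα : 0 < α) : 0 < riskConst K α := by
  have h : K⁻¹ < 1 := inv_lt_one_of_one_lt₀ hK
  have h1 : 0 < 1 - K⁻¹ := by linarith
  have h2 : 0 < 1 + α - K⁻¹ := by linarith
  have h3 : 0 < max (α + 2 * (1 + K⁻¹)) (2 * K) := lt_max_of_lt_right (by linarith)
  unfold riskConst
  positivity

/-! `penDelta` is well defined. -/

theorem measurable_sum_sq (k : ℕ) : Measurable fun z : Fin k → ℝ => ∑ i, z i ^ 2 := by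
  fun_prop

instance (k : ℕ) : IsProbabilityMeasure (chiSq k) := by
  unfold chiSq
  exact Measure.isProbabilityMeasure_map (measurable_sum_sq k).aemeasurable

theorem integrable_chiSq (k : ℕ) : Integrable (fun x : ℝ => x) (chiSq k) := by
  unfold chiSq
  rw [integrable_map_measure (by fun_prop) (measurable_sum_sq k).aemeasurable]
  refine integrable_finsetSum _ fun i _ => ?_
  have h : Integrable (fun x : ℝ => x ^ 2) (gaussianReal 0 1) :=
    (memLp_id_gaussianReal (μ := 0) (v := 1) 2).integrable_sq
  exact (measurePreserving_eval (fun _ : Fin k => gaussianReal 0 1) i).integrable_comp_of_integrable h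

theorem integral_chiSq (k : ℕ) : ∫ x, x ∂(chiSq k) = k := by
  unfold chiSq
  rw [integral_map (measurable_sum_sq k).aemeasurable (by fun_prop)]
  have h : Integrable (fun x : ℝ => x ^ 2) (gaussianReal 0 1) :=
    (memLp_id_gaussianReal (μ := 0) (v := 1) 2).integrable_sq
  have h1 : ∫ x : ℝ, x ^ 2 ∂(gaussianReal 0 1) = 1 := by
    have := variance_fun_id_gaussianReal (μ := 0) (v := 1)
    rw [variance_eq_integral (by fun_prop)] at this
    simpa using this
  have mp (i : Fin k) := measurePreserving_eval (fun _ : Fin k => gaussianReal 0 1) i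
  have h3 (i : Fin k) : Integrable (fun z : Fin k → ℝ => z i ^ 2)
      (Measure.pi fun _ : Fin k => gaussianReal 0 1) := (mp i).integrable_comp_of_integrable h
  rw [integral_finsetSum _ fun i _ => h3 i]
  have h2 (i : Fin k) :
      ∫ z : Fin k → ℝ, z i ^ 2 ∂(Measure.pi fun _ : Fin k => gaussianReal 0 1) = 1 := by
    have h4 := integral_map (mp i).aemeasurable (f := fun x : ℝ => x ^ 2) (by fun_prop)
    rw [(mp i).map_eq, h1] at h4
    exact h4.symm
  simp [h2]

theorem ae_pos_chiSq {k : ℕ} (hk : k ≠ 0) : ∀ᵐ x ∂(chiSq k), 0 < x := by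
  unfold chiSq
  rw [ae_map_iff (measurable_sum_sq k).aemeasurable measurableSet_Ioi]
  have i : Fin k := ⟨0, Nat.pos_of_ne_zero hk⟩
  have := nullSingletonClass_gaussianReal (μ := 0) (v := 1) one_ne_zero
  have h0 : ∀ᵐ x ∂(gaussianReal 0 1), x ≠ 0 := by
    simp [ae_iff, measure_singleton]
  have mp := measurePreserving_eval (fun _ : Fin k => gaussianReal 0 1) i
  have h1 := mp.quasiMeasurePreserving.ae h0
  filter_upwards [h1] with z hz
  have : 0 < z i ^ 2 := by positivity
  exact this.trans_le (Finset.single_le_sum (f := fun j => z j ^ 2) (fun j _ => sq_nonneg _)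
    (Finset.mem_univ i))

theorem existsUnique_integral_excess_eq (μ : Measure (ℝ × ℝ))
    (h1 : Integrable (fun w : ℝ × ℝ => w.1) μ)
    (hp : ∀ᵐ w ∂μ, 0 < w.2) (t : ℝ) (ht : 0 < t) (ht1 : t ≤ ∫ w, w.1 ∂μ) :
    ∃! c : ℝ, 0 ≤ c ∧ ∫ w, max (w.1 - c * w.2) 0 ∂μ = t := by
  have hm (c : ℝ) : AEStronglyMeasurable (fun w : ℝ × ℝ => max (w.1 - c * w.2) 0) μ := by
    fun_prop
  have hb (c : ℝ) (hc : 0 ≤ c) : ∀ᵐ w ∂μ, ‖max (w.1 - c * w.2) 0‖ ≤ |w.1| := by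
    filter_upwards [hp] with w hw
    rw [Real.norm_of_nonneg (le_max_right _ _)]
    have := mul_nonneg hc hw.le
    have := le_abs_self w.1
    exact max_le (by linarith) (abs_nonneg _)
  have hi (c : ℝ) (hc : 0 ≤ c) : Integrable (fun w : ℝ × ℝ => max (w.1 - c * w.2) 0) μ :=
    h1.abs.mono' (hm c) (hb c hc)
  have hcont : ContinuousOn (fun c => ∫ w, max (w.1 - c * w.2) 0 ∂μ) (Set.Ici 0) :=
    continuousOn_of_dominated (fun c _ => hm c) hb h1.abs
      (Eventually.of_forall fun w => by fun_prop)
  have hlim : Tendsto (fun c => ∫ w, max (w.1 - c * w.2) 0 ∂μ) atTop (𝓝 0) := by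
    have := tendsto_integral_filter_of_dominated_convergence (μ := μ) (l := (atTop : Filter ℝ))
      (F := fun c (w : ℝ × ℝ) => max (w.1 - c * w.2) 0) (f := fun _ => 0) (fun w => |w.1|)
      (Eventually.of_forall hm) ((eventually_ge_atTop 0).mono hb) h1.abs (by
        filter_upwards [hp] with w hw
        refine tendsto_const_nhds.congr' ?_
        filter_upwards [eventually_ge_atTop (w.1 / w.2)] with c hc
        rw [div_le_iff₀ hw] at hc
        exact (max_eq_right (by linarith)).symm)
    simpa using this
  have h0 : t ≤ ∫ w, max (w.1 - 0 * w.2) 0 ∂μ :=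
    ht1.trans (integral_mono h1 (hi 0 le_rfl) fun w => by simp)
  obtain ⟨b, hb0, hbt⟩ := ((eventually_ge_atTop (0 : ℝ)).and (hlim.eventually_lt_const ht)).exists
  obtain ⟨c, hc, hct⟩ := intermediate_value_Icc' hb0
    (hcont.mono fun x hx => hx.1) ⟨hbt.le, h0⟩
  have key : ∀ x y : ℝ, 0 ≤ x → x < y → ∫ w, max (w.1 - x * w.2) 0 ∂μ = t →
      ∫ w, max (w.1 - y * w.2) 0 ∂μ = t → False := by
    intro x y hx hxy ex ey
    have hle : ∀ᵐ w ∂μ, 0 ≤ max (w.1 - x * w.2) 0 - max (w.1 - y * w.2) 0 := by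
      filter_upwards [hp] with w hw
      have := mul_le_mul_of_nonneg_right hxy.le hw.le
      exact sub_nonneg.2 (max_le_max (by linarith) le_rfl)
    have hz : ∫ w, (max (w.1 - x * w.2) 0 - max (w.1 - y * w.2) 0) ∂μ = 0 := by
      rw [integral_sub (hi x hx) (hi y (hx.trans hxy.le)), ex, ey, sub_self]
    rw [integral_eq_zero_iff_of_nonneg_ae hle ((hi x hx).sub (hi y (hx.trans hxy.le)))] at hz
    have : ∫ w, max (w.1 - x * w.2) 0 ∂μ = 0 := by
      refine integral_eq_zero_of_ae ?_
      filter_upwards [hp, hz] with w hw hzw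
      have h3 := mul_lt_mul_of_pos_right hxy hw
      simp only [Pi.zero_apply, sub_eq_zero] at hzw
      by_contra hne
      have h4 : 0 < w.1 - x * w.2 := by
        by_contra h5
        exact hne (max_eq_right (not_lt.1 h5))
      rw [max_eq_left h4.le] at hzw
      rcases max_choice (w.1 - y * w.2) 0 with h6 | h6 <;> rw [h6] at hzw <;> linarith
    linarith
  refine ⟨c, ⟨hc.1, hct⟩, fun c' ⟨hc', hct'⟩ => ?_⟩
  rcases lt_trichotomy c' c with h | h | h
  · exact (key c' c hc' h hct' hct).elim
  · exact h
  · exact (key c c' hc.1 h hct hct').elim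

theorem existsUnique_expectedExcess_eq {n d : ℕ} (hd : d + 2 ≤ n) {t : ℝ} (ht : 0 < t)
    (ht1 : t ≤ 1) : ∃! x : ℝ, 0 ≤ x ∧ expectedExcess n d x = t := by
  have hN : (0 : ℝ) < (n : ℝ) - d := by
    have : (d : ℝ) + 2 ≤ n := by exact_mod_cast hd
    linarith
  have h1 : Integrable (fun w : ℝ × ℝ => w.1)
      ((chiSq (d + 1)).prod (chiSq (n - d - 1))) := (integrable_chiSq _).comp_fst _
  have hp : ∀ᵐ w ∂((chiSq (d + 1)).prod (chiSq (n - d - 1))), 0 < w.2 :=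
    Measure.quasiMeasurePreserving_snd.ae (ae_pos_chiSq (by omega))
  have he : ∫ w, w.1 ∂((chiSq (d + 1)).prod (chiSq (n - d - 1))) = (d : ℝ) + 1 := by
    rw [integral_fun_fst (fun x : ℝ => x), integral_chiSq]
    simp
  obtain ⟨c, ⟨hc, hct⟩, hu⟩ := existsUnique_integral_excess_eq _ h1 hp t ht
    (by rw [he]; have : (0 : ℝ) ≤ d := d.cast_nonneg; linarith)
  refine ⟨c * ((n : ℝ) - d), ⟨by positivity, ?_⟩, fun x ⟨hx, hxt⟩ => ?_⟩
  · unfold expectedExcess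
    rw [mul_div_cancel_right₀ _ hN.ne']
    exact hct
  · rw [← hu (x / ((n : ℝ) - d)) ⟨by positivity, hxt⟩, div_mul_cancel₀ _ hN.ne']

theorem penDelta_spec {n : ℕ} (Δ : Submodule ℝ (Vec n) → ℝ≥0) (S : Submodule ℝ (Vec n))
    (hS : Module.finrank ℝ S + 2 ≤ n) :
    0 ≤ penDelta Δ S ∧
      expectedExcess n (Module.finrank ℝ S) (penDelta Δ S) = Real.exp (-(Δ S : ℝ)) := by
  obtain ⟨x, hx, hu⟩ := existsUnique_expectedExcess_eq hS (Real.exp_pos (-(Δ S : ℝ)))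
    (Real.exp_le_one_iff.2 (by simp))
  have : {x : ℝ | 0 ≤ x ∧
      expectedExcess n (Module.finrank ℝ S) x = Real.exp (-(Δ S : ℝ))} = {x} :=
    Set.eq_singleton_iff_unique_mem.2 ⟨hx, hu⟩
  rw [penDelta, this, csInf_singleton]
  exact hx

end EstimatorSelection

end

open EstimatorSelection

namespace EstimatorSelection

/-! Write e = Y - f for the noise. For an estimate g and a space S, ‖Y - Π_S g‖² = ‖e‖² + 2⟨e, f -
Π_S g⟩ + ‖f - Π_S g‖². The vector f - Π_S g lies in a space T ⊇ S that contains f and has dimension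
dim S + 1, so the cross term is at most K‖Π_T e‖² + K⁻¹‖f - Π_S g‖². As f ∈ T, e - Π_T e is the
residual of Y on T, hence no longer than its residual on S; the penalty therefore pays for K‖Π_T e‖²
up to K times `noiseExcess`. The definition of pen_Δ makes the expected excess exactly σ²
exp(-Δ(S)), because the two parts of e/σ have independent χ² squared norms. The sum of the excesses
over the countable family bounds them all at once, whichever spaces the data select, and costs Σσ².

The criterion is thus bounded below at the selected estimator (`le_crit_term`) and above at any
competitor (`crit_term_le`); ‖e‖² cancels in the comparison (`risk_le_of_crit_le`), and integration
gives the risk bound.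

For the accuracy index, an exponential moment bound shows pen_Δ(S) ≤ c(κ) (dim S ∨ Δ(S))
(`penDelta_le`). The residual in the variance estimator splits into Y - f, f - g and g - Π_S g; the
first has squared norm at most 2nσ² up to a remainder of expectation at most 4σ²
(`accuracy_term_le`). -/

/-! ### Gaussian noise split along a subspace and its orthogonal complement. -/

theorem exists_finrank_succ_containing {n : ℕ} (S : Submodule ℝ (Vec n)) (f : Vec n)
    (hS : Module.finrank ℝ S + 1 ≤ n) :
    ∃ T : Submodule ℝ (Vec n), S ≤ T ∧ f ∈ T ∧ Module.finrank ℝ T = Module.finrank ℝ S + 1 := by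
  -- Even when f ∈ S a new direction is added, so that the dimension is exactly dim S + 1, the
  -- number of degrees of freedom in the definition of pen_Δ.
  obtain ⟨v, hv, hf⟩ : ∃ v, v ∉ S ∧ f ∈ S ⊔ Submodule.span ℝ {v} := by
    by_cases hf : f ∈ S
    · obtain ⟨v, hv⟩ : ∃ v, v ∉ S := by
        by_contra! h
        have hT : S = ⊤ := eq_top_iff.2 fun x _ => h x
        rw [hT, finrank_top, finrank_euclideanSpace_fin] at hS
        omega
      exact ⟨v, hv, Submodule.mem_sup_left hf⟩
    · exact ⟨f, hf, Submodule.mem_sup_right (Submodule.mem_span_singleton_self f)⟩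
  refine ⟨S ⊔ Submodule.span ℝ {v}, le_sup_left, hf, ?_⟩
  rw [Submodule.finrank_sup_span_singleton hv]

/-- Orthonormal bases of T and of Tᗮ are concatenated. In the resulting coordinates the projections
onto T and Tᗮ read disjoint blocks, which yields their independence under the Gaussian law. -/
theorem exists_orthonormalBasis_adapted {n m : ℕ} (T : Submodule ℝ (Vec n))
    (hm : Module.finrank ℝ T = m) :
    ∃ b : OrthonormalBasis (Fin m ⊕ Fin (n - m)) ℝ (Vec n),
      (∀ i, b (Sum.inl i) ∈ T) ∧ ∀ j, b (Sum.inr j) ∈ Tᗮ := by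
  have hmn : m ≤ n := by
    have := Submodule.finrank_le T
    rwa [finrank_euclideanSpace_fin, hm] at this
  have hcT : Module.finrank ℝ Tᗮ = n - m := by
    have := T.finrank_add_finrank_orthogonal
    rw [finrank_euclideanSpace_fin] at this
    omega
  let bT := (stdOrthonormalBasis ℝ T).reindex (finCongr hm)
  let bO := (stdOrthonormalBasis ℝ Tᗮ).reindex (finCongr hcT)
  let v : Fin m ⊕ Fin (n - m) → Vec n := Sum.elim (fun i => (bT i : Vec n)) fun j => (bO j : Vec n)
  have hv : Orthonormal ℝ v := by
    have h1 := bT.orthonormal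
    have h2 := bO.orthonormal
    rw [orthonormal_iff_ite] at h1 h2 ⊢
    rintro (i | i) (j | j)
    · simpa [v] using h1 i j
    · simpa [v] using T.inner_right_of_mem_orthogonal (bT i).2 (bO j).2
    · simpa [v] using T.inner_left_of_mem_orthogonal (bT j).2 (bO i).2
    · simpa [v] using h2 i j
  -- The family already has n vectors, so extending it from the whole index set only repackages it
  -- as a basis.
  obtain ⟨b, hb⟩ := Orthonormal.exists_orthonormalBasis_extension_of_card_eq
    (ι := Fin m ⊕ Fin (n - m)) (𝕜 := ℝ) (E := Vec n) (v := v) (s := Set.univ)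
    (by rw [finrank_euclideanSpace_fin, Fintype.card_sum, Fintype.card_fin, Fintype.card_fin]; omega)
    (hv.comp _ Subtype.val_injective)
  refine ⟨b, fun i => ?_, fun j => ?_⟩
  · rw [hb _ trivial]; exact (bT i).2
  · rw [hb _ trivial]; exact (bO j).2

/-- Under the standard Gaussian law, the squared norms of the projections onto a subspace and onto
its orthogonal complement are independent `χ²` variables. -/
theorem map_norm_sq_projection_stdGaussian {n m : ℕ} (T : Submodule ℝ (Vec n))
    (hm : Module.finrank ℝ T = m) :
    (stdGaussian (Vec n)).map
        (fun z => (‖T.starProjection z‖ ^ 2, ‖z - T.starProjection z‖ ^ 2)) =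
      (chiSq m).prod (chiSq (n - m)) := by
  obtain ⟨b, hbT, hbO⟩ := exists_orthonormalBasis_adapted T hm
  rw [stdGaussian_eq_map_pi_orthonormalBasis b, Measure.map_map (by fun_prop) (by fun_prop)]
  have hmp := measurePreserving_sumPiEquivProdPi (fun _ : Fin m ⊕ Fin (n - m) => gaussianReal 0 1)
  have hfun : (fun z => (‖T.starProjection z‖ ^ 2, ‖z - T.starProjection z‖ ^ 2)) ∘
      (fun x : Fin m ⊕ Fin (n - m) → ℝ => ∑ i, x i • b i) =
      (Prod.map (fun z : Fin m → ℝ => ∑ i, z i ^ 2) (fun z : Fin (n - m) → ℝ => ∑ i, z i ^ 2)) ∘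
        MeasurableEquiv.sumPiEquivProdPi (fun _ : Fin m ⊕ Fin (n - m) => ℝ) := by
    ext1 x
    have hsum : ∑ i, x i • b i =
        ∑ i, x (Sum.inl i) • b (Sum.inl i) + ∑ j, x (Sum.inr j) • b (Sum.inr j) :=
      Fintype.sum_sum_type _
    have hT : ∑ i, x (Sum.inl i) • b (Sum.inl i) ∈ T :=
      T.sum_mem fun i _ => T.smul_mem _ (hbT i)
    have hO : ∑ j, x (Sum.inr j) • b (Sum.inr j) ∈ Tᗮ :=
      Tᗮ.sum_mem fun i _ => Tᗮ.smul_mem _ (hbO i)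
    have hp : T.starProjection (∑ i, x i • b i) = ∑ i, x (Sum.inl i) • b (Sum.inl i) := by
      rw [hsum, map_add, Submodule.starProjection_eq_self_iff.2 hT,
        (Submodule.starProjection_apply_eq_zero_iff T).2 hO, add_zero]
    have hl : Orthonormal ℝ fun i => b (Sum.inl i) := b.orthonormal.comp _ Sum.inl_injective
    have hr : Orthonormal ℝ fun i => b (Sum.inr i) := b.orthonormal.comp _ Sum.inr_injective
    simp only [Function.comp_apply, hp, Prod.map]
    rw [hsum, add_sub_cancel_left, ← real_inner_self_eq_norm_sq, ← real_inner_self_eq_norm_sq,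
      hl.inner_sum, hr.inner_sum]
    simp [MeasurableEquiv.coe_sumPiEquivProdPi, Equiv.sumPiEquivProdPi, pow_two]
  rw [hfun, ← Measure.map_map (by fun_prop) (MeasurableEquiv.measurable _), hmp.map_eq,
    ← Measure.map_prod_map _ _ (measurable_sum_sq m) (measurable_sum_sq _)]
  rfl

theorem map_norm_sq_stdGaussian (n : ℕ) :
    (stdGaussian (Vec n)).map (fun z => ‖z‖ ^ 2) = chiSq n := by
  rw [← map_pi_eq_stdGaussian, Measure.map_map (by fun_prop) (by fun_prop)]
  simp [chiSq, Function.comp_def, EuclideanSpace.real_norm_sq_eq]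

/-- A vector with independent Gaussian coordinates of common variance is a scaled and translated
standard Gaussian vector. -/
theorem hasLaw_of_iIndepFun_gaussianReal {n : ℕ} {Ω : Type*} [MeasurableSpace Ω] {μ : Measure Ω}
    {f : Vec n} {σ : ℝ≥0} {Y : Ω → Vec n}
    (hind : iIndepFun (fun (i : Fin n) (ω : Ω) => Y ω i) μ)
    (hlaw : ∀ i : Fin n, HasLaw (fun ω : Ω => Y ω i) (gaussianReal (f i) (σ ^ 2)) μ) :
    HasLaw Y ((stdGaussian (Vec n)).map fun z => f + (σ : ℝ) • z) μ := by
  have h := hind.hasLaw_pi hlaw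
  have hm : AEMeasurable Y μ := by
    have h2 : AEMeasurable (fun ω => WithLp.toLp 2 (fun i => Y ω i)) μ :=
      (by fun_prop : Measurable (WithLp.toLp 2 : (Fin n → ℝ) → Vec n)).comp_aemeasurable
        h.aemeasurable
    exact h2
  refine ⟨hm, ?_⟩
  have h1 : (fun i => gaussianReal (f i) (σ ^ 2)) =
      fun i => (gaussianReal 0 1).map (fun x => f i + (σ : ℝ) * x) := by
    ext1 i
    have : (fun x : ℝ => f i + (σ : ℝ) * x) = (f i + ·) ∘ ((σ : ℝ) * ·) := rfl
    rw [this, ← Measure.map_map (by fun_prop) (by fun_prop), gaussianReal_map_const_mul,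
      gaussianReal_map_const_add]
    congr 1
    · simp
    · ext; simp
  have h2 : μ.map Y = (μ.map (fun ω i => Y ω i)).map (WithLp.toLp 2) := by
    rw [AEMeasurable.map_map_of_aemeasurable (by fun_prop) h.aemeasurable]
    rfl
  rw [h2, h.map_eq, ← map_pi_eq_stdGaussian, Measure.map_map (by fun_prop) (by fun_prop)]
  have h3 (i : Fin n) : IsProbabilityMeasure
      ((gaussianReal 0 1).map (fun x => f i + (σ : ℝ) * x)) :=
    Measure.isProbabilityMeasure_map (by fun_prop)
  rw [h1, ← Measure.pi_map_pi (fun i => by fun_prop),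
    Measure.map_map (by fun_prop) (by fun_prop)]
  rfl

theorem integrable_excess_chiSq (m k : ℕ) {c : ℝ} :
    Integrable (fun w : ℝ × ℝ => max (w.1 - c * w.2) 0) ((chiSq m).prod (chiSq k)) :=
  Integrable.pos_part (((integrable_chiSq m).comp_fst _).sub
    (((integrable_chiSq k).comp_snd _).const_mul c))

/-- The expected excess of the noise in a subspace `T` over a multiple of the noise in its
orthogonal complement. -/
theorem lintegral_excess_eq {n d : ℕ} {Ω : Type*} [MeasurableSpace Ω] {μ : Measure Ω}
    {f : Vec n} {σ : ℝ≥0} {Y : Ω → Vec n}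
    (hY : HasLaw Y ((stdGaussian (Vec n)).map fun z => f + (σ : ℝ) • z) μ)
    (T : Submodule ℝ (Vec n)) (hT : Module.finrank ℝ T = d + 1) (x : ℝ) :
    ∫⁻ ω, ENNReal.ofReal (‖T.starProjection (Y ω - f)‖ ^ 2 -
        x / ((n : ℝ) - d) * ‖Y ω - f - T.starProjection (Y ω - f)‖ ^ 2) ∂μ =
      ENNReal.ofReal (expectedExcess n d x * (σ : ℝ) ^ 2) := by
  rw [hY.lintegral_comp (f := fun y => ENNReal.ofReal (‖T.starProjection (y - f)‖ ^ 2 -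
        x / ((n : ℝ) - d) * ‖y - f - T.starProjection (y - f)‖ ^ 2))
        (Measurable.aemeasurable (by fun_prop)),
    lintegral_map (by fun_prop) (by fun_prop)]
  have h1 : ∀ z : Vec n, ENNReal.ofReal (‖T.starProjection (f + (σ : ℝ) • z - f)‖ ^ 2 -
        x / ((n : ℝ) - d) * ‖f + (σ : ℝ) • z - f - T.starProjection (f + (σ : ℝ) • z - f)‖ ^ 2) =
      ENNReal.ofReal ((σ : ℝ) ^ 2) * (fun w : ℝ × ℝ => ENNReal.ofReal
        (max (w.1 - x / ((n : ℝ) - d) * w.2) 0))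
        (‖T.starProjection z‖ ^ 2, ‖z - T.starProjection z‖ ^ 2) := by
    intro z
    have hpos (a : ℝ) : ENNReal.ofReal (max a 0) = ENNReal.ofReal a := by
      simp [ENNReal.ofReal_max]
    simp only [add_sub_cancel_left, map_smul, ← smul_sub, norm_smul, hpos,
      ← ENNReal.ofReal_mul (sq_nonneg (σ : ℝ))]
    congr 1
    simp only [Real.norm_eq_abs, mul_pow, sq_abs]
    ring
  simp only [h1]
  rw [lintegral_const_mul _ (by fun_prop)]
  rw [← lintegral_map (f := fun w : ℝ × ℝ => ENNReal.ofReal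
        (max (w.1 - x / ((n : ℝ) - d) * w.2) 0))
      (g := fun z => (‖T.starProjection z‖ ^ 2, ‖z - T.starProjection z‖ ^ 2))
      (by fun_prop) (by fun_prop), map_norm_sq_projection_stdGaussian T hT, ← Nat.sub_sub,
    ← ofReal_integral_eq_lintegral_ofReal (integrable_excess_chiSq _ _)
      (Eventually.of_forall fun w => le_max_right _ _),
    ← ENNReal.ofReal_mul (sq_nonneg _), mul_comm]
  rfl

/-! ### Laplace transform of the χ² law. -/

theorem integral_exp_neg_mul_sq_gaussianReal {t : ℝ} (ht : -(1 / 2) < t) :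
    ∫ z, Real.exp (-t * z ^ 2) ∂(gaussianReal 0 1) = (√(1 + 2 * t))⁻¹ := by
  rw [integral_gaussianReal_eq_integral_smul one_ne_zero]
  have h : ∀ z : ℝ, gaussianPDFReal 0 1 z • Real.exp (-t * z ^ 2) =
      (√(2 * Real.pi))⁻¹ * Real.exp (-(t + 1 / 2) * z ^ 2) := by
    intro z
    rw [gaussianPDFReal, smul_eq_mul, mul_assoc, ← Real.exp_add]
    simp only [NNReal.coe_one, mul_one]
    congr 2
    ring
  simp only [h]
  rw [integral_const_mul, integral_gaussian, ← Real.sqrt_inv, ← Real.sqrt_inv,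
    ← Real.sqrt_mul (by positivity)]
  congr 1
  have := Real.pi_pos
  have h1 : 1 + 2 * t ≠ 0 := by linarith
  have h2 : t + 1 / 2 ≠ 0 := by linarith
  have h3 : t + 1 / 2 = (1 + 2 * t) / 2 := by ring
  rw [h3]
  field_simp

theorem integral_exp_neg_mul_chiSq (k : ℕ) {t : ℝ} (ht : -(1 / 2) < t) :
    ∫ x, Real.exp (-t * x) ∂(chiSq k) = (√(1 + 2 * t))⁻¹ ^ k := by
  unfold chiSq
  rw [integral_map (measurable_sum_sq k).aemeasurable (by fun_prop)]
  simp only [Finset.mul_sum, Real.exp_sum]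
  rw [integral_fintype_prod_eq_pow (fun z : ℝ => Real.exp (-t * z ^ 2)),
    integral_exp_neg_mul_sq_gaussianReal ht, Fintype.card_fin]

theorem integrable_exp_neg_mul_chiSq (k : ℕ) {t : ℝ} (ht : -(1 / 2) < t) :
    Integrable (fun x => Real.exp (-t * x)) (chiSq k) := by
  -- The Bochner integral of a non-integrable function is 0, whereas the computed value is positive.
  by_contra h
  have h1 := integral_undef h
  rw [integral_exp_neg_mul_chiSq k ht] at h1
  have : 0 < √(1 + 2 * t) := Real.sqrt_pos.2 (by linarith)
  exact absurd h1 (by positivity)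

/-! ### Deterministic bounds on the criterion. -/

theorem norm_sub_starProjection_le {n : ℕ} (T : Submodule ℝ (Vec n)) (y : Vec n) {w : Vec n}
    (hw : w ∈ T) : ‖y - T.starProjection y‖ ≤ ‖y - w‖ := by
  rw [Submodule.starProjection_minimal]
  exact ciInf_le ⟨0, by rintro _ ⟨x, rfl⟩; exact norm_nonneg _⟩ (⟨w, hw⟩ : T)

theorem abs_two_mul_inner_le {n : ℕ} (T : Submodule ℝ (Vec n)) (e : Vec n) {u : Vec n}
    (hu : u ∈ T) {K : ℝ} (hK : 0 < K) :
    |2 * inner ℝ e u| ≤ K * ‖T.starProjection e‖ ^ 2 + K⁻¹ * ‖u‖ ^ 2 := by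
  have h1 : inner ℝ e u = inner ℝ (T.starProjection e) u := by
    rw [Submodule.inner_starProjection_left_eq_right, Submodule.starProjection_eq_self_iff.2 hu]
  have h2 := abs_real_inner_le_norm (T.starProjection e) u
  rw [h1, abs_mul, abs_two]
  have h3 : K * ‖T.starProjection e‖ ^ 2 + K⁻¹ * ‖u‖ ^ 2 -
      2 * (‖T.starProjection e‖ * ‖u‖) = K⁻¹ * (K * ‖T.starProjection e‖ - ‖u‖) ^ 2 := by
    field_simp
    ring
  have h4 : 0 ≤ K⁻¹ * (K * ‖T.starProjection e‖ - ‖u‖) ^ 2 := by positivity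
  linarith

theorem sigmaHatSq_nonneg {n : ℕ} {S : Submodule ℝ (Vec n)} (y : Vec n)
    (hN : 0 < (n : ℝ) - Module.finrank ℝ S) : 0 ≤ sigmaHatSq S y := by
  unfold sigmaHatSq
  positivity

/-- The part of the noise `e` in `T` that is not compensated by a multiple of its part orthogonal
to `T`. -/
noncomputable def noiseExcess {n : ℕ} (T : Submodule ℝ (Vec n)) (c : ℝ) (e : Vec n) : ℝ :=
  max (‖T.starProjection e‖ ^ 2 - c * ‖e - T.starProjection e‖ ^ 2) 0

/-- The penalty absorbs the noise in T: since f ∈ T and S ≤ T, the noise orthogonal to T is the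
residual of y on T, which is dominated by the residual on S that enters `sigmaHatSq`. -/
theorem mul_norm_sq_projection_le {n : ℕ} {S T : Submodule ℝ (Vec n)} (hST : S ≤ T)
    {f y : Vec n} (hf : f ∈ T) {K x p : ℝ} (hK : 0 < K) (hx : 0 ≤ x) (hp : K * x ≤ p)
    (hN : 0 < (n : ℝ) - Module.finrank ℝ S) :
    K * ‖T.starProjection (y - f)‖ ^ 2 ≤ p * sigmaHatSq S y +
      K * noiseExcess T (x / ((n : ℝ) - Module.finrank ℝ S)) (y - f) := by
  have h1 : ‖y - f - T.starProjection (y - f)‖ ≤ ‖y - S.starProjection y‖ := by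
    have := norm_sub_starProjection_le T y (hST (S.starProjection_apply_mem y))
    rwa [map_sub, Submodule.starProjection_eq_self_iff.2 hf, sub_sub_sub_cancel_right]
  have h2 : K * (x / ((n : ℝ) - Module.finrank ℝ S) *
      ‖y - f - T.starProjection (y - f)‖ ^ 2) ≤ p * sigmaHatSq S y := by
    calc _ ≤ K * (x / ((n : ℝ) - Module.finrank ℝ S) * ‖y - S.starProjection y‖ ^ 2) := by
          gcongr
      _ = K * x * sigmaHatSq S y := by unfold sigmaHatSq; ring
      _ ≤ p * sigmaHatSq S y := by gcongr; exact sigmaHatSq_nonneg y hN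
  have h3 := mul_le_mul_of_nonneg_left (le_max_left (‖T.starProjection (y - f)‖ ^ 2 -
    x / ((n : ℝ) - Module.finrank ℝ S) * ‖y - f - T.starProjection (y - f)‖ ^ 2) 0) hK.le
  unfold noiseExcess
  linarith

/-- The difference of the two sides is (a u - b v)² / (a + b). With a = 1 - K⁻¹ and b = α the factor
on the left is the numerator constant of `riskConst`. -/
theorem mul_add_sq_le {a b u v : ℝ} (ha : 0 < a) (hb : 0 < b) :
    a * b / (a + b) * (u + v) ^ 2 ≤ a * u ^ 2 + b * v ^ 2 := by
  rw [div_mul_eq_mul_div, div_le_iff₀ (by positivity)]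
  nlinarith [sq_nonneg (a * u - b * v)]

/-- The cross term uses up K⁻¹‖f - Π_S g‖² and the whole penalty. What remains, (1 - K⁻¹)‖f - Π_S
g‖² + α‖g - Π_S g‖², controls ‖f - g‖² by the triangle inequality. -/
theorem le_crit_term {n : ℕ} {S T : Submodule ℝ (Vec n)} (hST : S ≤ T)
    {f y : Vec n} (g : Vec n) (hf : f ∈ T) {K α x p : ℝ} (hK : 1 < K) (hα : 0 < α) (hx : 0 ≤ x)
    (hp : K * x ≤ p) (hN : 0 < (n : ℝ) - Module.finrank ℝ S) :
    α * (1 - K⁻¹) / (1 + α - K⁻¹) * ‖f - g‖ ^ 2 + ‖y - f‖ ^ 2 -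
        K * noiseExcess T (x / ((n : ℝ) - Module.finrank ℝ S)) (y - f) ≤
      ‖y - S.starProjection g‖ ^ 2 + α * ‖g - S.starProjection g‖ ^ 2 + p * sigmaHatSq S y := by
  have h1 := mul_norm_sq_projection_le hST (y := y) hf (by linarith) hx hp hN
  have hu : f - S.starProjection g ∈ T := T.sub_mem hf (hST (S.starProjection_apply_mem g))
  have h2 := (abs_le.1 (abs_two_mul_inner_le T (y - f) hu (by linarith : 0 < K))).1
  have h3 : ‖y - S.starProjection g‖ ^ 2 = ‖y - f‖ ^ 2 +
      2 * inner ℝ (y - f) (f - S.starProjection g) + ‖f - S.starProjection g‖ ^ 2 := by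
    rw [← norm_add_sq_real, sub_add_sub_cancel]
  have hK1 : K⁻¹ < 1 := inv_lt_one_of_one_lt₀ hK
  have h4 := mul_add_sq_le (u := ‖f - S.starProjection g‖) (v := ‖g - S.starProjection g‖)
    (sub_pos.2 hK1) hα
  have h5 : ‖f - g‖ ≤ ‖f - S.starProjection g‖ + ‖g - S.starProjection g‖ := by
    have := norm_sub_le (f - S.starProjection g) (g - S.starProjection g)
    rwa [sub_sub_sub_cancel_right] at this
  have h6 : α * (1 - K⁻¹) / (1 + α - K⁻¹) * ‖f - g‖ ^ 2 ≤
      (1 - K⁻¹) * α / (1 - K⁻¹ + α) *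
        (‖f - S.starProjection g‖ + ‖g - S.starProjection g‖) ^ 2 := by
    have h7 : α * (1 - K⁻¹) / (1 + α - K⁻¹) = (1 - K⁻¹) * α / (1 - K⁻¹ + α) := by
      congr 1 <;> ring
    rw [h7]
    have := sub_pos.2 hK1
    gcongr
  linarith

/-- Here the cross term adds K⁻¹‖f - Π_S g‖² and a second copy of the penalty. Splitting f - Π_S g
through g gives the coefficients 2(1 + K⁻¹), α + 2(1 + K⁻¹) and 2, all at most the maximum; its
entry 2K serves later to absorb the two noise excesses. -/
theorem crit_term_le {n : ℕ} {S T : Submodule ℝ (Vec n)} (hST : S ≤ T)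
    {f y : Vec n} (g : Vec n) (hf : f ∈ T) {K α x p : ℝ} (hK : 1 < K) (hα : 0 < α) (hx : 0 ≤ x)
    (hp : K * x ≤ p) (hN : 0 < (n : ℝ) - Module.finrank ℝ S) :
    ‖y - S.starProjection g‖ ^ 2 + α * ‖g - S.starProjection g‖ ^ 2 + p * sigmaHatSq S y ≤
      ‖y - f‖ ^ 2 + max (α + 2 * (1 + K⁻¹)) (2 * K) * (‖f - g‖ ^ 2 +
        (‖g - S.starProjection g‖ ^ 2 + p * sigmaHatSq S y)) +
        K * noiseExcess T (x / ((n : ℝ) - Module.finrank ℝ S)) (y - f) := by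
  have hK0 : 0 < K := by linarith
  have h1 := mul_norm_sq_projection_le hST (y := y) hf hK0 hx hp hN
  have hu : f - S.starProjection g ∈ T := T.sub_mem hf (hST (S.starProjection_apply_mem g))
  have h2 := (abs_le.1 (abs_two_mul_inner_le T (y - f) hu hK0)).2
  have h3 : ‖y - S.starProjection g‖ ^ 2 = ‖y - f‖ ^ 2 +
      2 * inner ℝ (y - f) (f - S.starProjection g) + ‖f - S.starProjection g‖ ^ 2 := by
    rw [← norm_add_sq_real, sub_add_sub_cancel]
  have h5 : ‖f - S.starProjection g‖ ≤ ‖f - g‖ + ‖g - S.starProjection g‖ := by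
    have := norm_add_le (f - g) (g - S.starProjection g)
    rwa [sub_add_sub_cancel] at this
  have h6 : ‖f - S.starProjection g‖ ^ 2 ≤ 2 * (‖f - g‖ ^ 2 + ‖g - S.starProjection g‖ ^ 2) :=
    (pow_le_pow_left₀ (norm_nonneg _) h5 2).trans (by
      nlinarith [sq_nonneg (‖f - g‖ - ‖g - S.starProjection g‖)])
  have hi : 0 < K⁻¹ := inv_pos.2 hK0
  have h7 := mul_le_mul_of_nonneg_left h6 (by positivity : 0 ≤ 1 + K⁻¹)
  set M := max (α + 2 * (1 + K⁻¹)) (2 * K)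
  have hM1 : α + 2 * (1 + K⁻¹) ≤ M := le_max_left _ _
  have hM2 : 2 ≤ M := (by linarith : 2 ≤ 2 * K).trans (le_max_right _ _)
  have hp0 : 0 ≤ p := (by positivity : 0 ≤ K * x).trans hp
  have h8 := mul_le_mul_of_nonneg_right hM1 (sq_nonneg ‖g - S.starProjection g‖)
  have h9 := mul_le_mul_of_nonneg_right (by linarith : 2 * (1 + K⁻¹) ≤ M) (sq_nonneg ‖f - g‖)
  have h10 := mul_le_mul_of_nonneg_right hM2 (mul_nonneg hp0 (sigmaHatSq_nonneg y hN))
  linarith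

/-- The pointwise form of the risk bound, with an abstract noise bound `B`. -/
theorem risk_le_of_crit_le {n : ℕ} {Λ : Type*} {SS : Set (Submodule ℝ (Vec n))}
    (hdim : ∀ S ∈ SS, Module.finrank ℝ S + 2 ≤ n)
    {Tl : Λ → Set (Submodule ℝ (Vec n))} (hTl : ∀ l, Tl l ⊆ SS)
    {pen : Submodule ℝ (Vec n) → ℝ≥0} {x : Submodule ℝ (Vec n) → ℝ} (hx : ∀ S ∈ SS, 0 ≤ x S)
    {K α δ : ℝ} (hK : 1 < K) (hα : 0 < α) (hδ : 0 ≤ δ) (hp : ∀ S ∈ SS, K * x S ≤ pen S)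
    {f y : Vec n} {ext : Submodule ℝ (Vec n) → Submodule ℝ (Vec n)}
    (hext : ∀ S ∈ SS, S ≤ ext S ∧ f ∈ ext S) {B : ℝ≥0∞}
    (hB : ∀ S ∈ SS, ENNReal.ofReal
      (noiseExcess (ext S) (x S / ((n : ℝ) - Module.finrank ℝ S)) (y - f)) ≤ B)
    (g : Λ → Vec n) (lhat : Λ)
    (hl : crit α pen (Tl lhat) y (g lhat) ≤
      (⨅ l, crit α pen (Tl l) y (g l)) + ENNReal.ofReal δ) :
    ENNReal.ofReal (riskConst K α) * ENNReal.ofReal (‖f - g lhat‖ ^ 2) ≤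
      (⨅ l, (ENNReal.ofReal (‖f - g l‖ ^ 2) + accuracy pen (Tl l) y (g l))) + B +
        ENNReal.ofReal δ := by
  by_cases hBt : B = ∞
  · simp [hBt]
  have hN (S) (hS : S ∈ SS) : 0 < (n : ℝ) - Module.finrank ℝ S := by
    have : (Module.finrank ℝ S : ℝ) + 2 ≤ n := by exact_mod_cast hdim S hS
    linarith
  lift B to ℝ≥0 using hBt
  have hB' (S) (hS : S ∈ SS) :
      noiseExcess (ext S) (x S / ((n : ℝ) - Module.finrank ℝ S)) (y - f) ≤ B := by
    have := hB S hS
    rwa [ENNReal.ofReal_le_iff_le_toReal ENNReal.coe_ne_top, ENNReal.coe_toReal] at this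
  have hK0 : 0 < K := by linarith
  set M := max (α + 2 * (1 + K⁻¹)) (2 * K) with hM
  have hMK : 2 * K ≤ M := le_max_right _ _
  have hM0 : 0 < M := by linarith
  rw [add_assoc, ENNReal.iInf_add]
  refine le_iInf fun l => ?_
  unfold accuracy
  by_cases hne : (Tl l).Nonempty
  swap
  · simp [Set.not_nonempty_iff_eq_empty.1 hne]
  simp only [ENNReal.add_iInf, ENNReal.iInf_add]
  refine le_iInf₂ fun S hS => ?_
  have hSS := hTl l hS
  have hcrit := hl.trans (add_le_add_left ((iInf_le _ l).trans (iInf₂_le S hS)) _)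
  set c0 := α * (1 - K⁻¹) / (1 + α - K⁻¹) with hc0
  -- The bound must hold for every space of the selected subfamily, which is why `B` dominates the
  -- excess uniformly over `SS`. An empty subfamily is harmless: the criterion is then infinite.
  have hlow : ENNReal.ofReal (c0 * ‖f - g lhat‖ ^ 2 + ‖y - f‖ ^ 2 - K * B) ≤
      crit α pen (Tl lhat) y (g lhat) := by
    refine le_iInf₂ fun S' hS' => ENNReal.ofReal_le_ofReal ?_
    have hSS' := hTl lhat hS'
    refine le_trans ?_ (le_crit_term (hext S' hSS').1 (g lhat) (hext S' hSS').2 hK hα (hx S' hSS')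
      (hp S' hSS') (hN S' hSS'))
    have := mul_le_mul_of_nonneg_left (hB' S' hSS') hK0.le
    linarith
  have hσ := sigmaHatSq_nonneg y (hN S hSS)
  have h1 := hlow.trans hcrit
  rw [← ENNReal.ofReal_add (by positivity) hδ, ENNReal.ofReal_le_ofReal_iff (by positivity)] at h1
  have h2 := crit_term_le (y := y) (hext S hSS).1 (g l) (hext S hSS).2 hK hα (hx S hSS)
      (hp S hSS) (hN S hSS)
  have h3 := mul_le_mul_of_nonneg_left (hB' S hSS) hK0.le
  have h4 := mul_le_mul_of_nonneg_right hMK B.2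
  have h5 := mul_le_mul_of_nonneg_right (by linarith : 1 ≤ M) hδ
  rw [← hM] at h2
  have hr : riskConst K α = c0 / M := by
    rw [hc0, hM, riskConst, div_div]
  rw [← ENNReal.ofReal_mul (riskConst_pos hK hα).le,
    ← ENNReal.ofReal_coe_nnreal, ← ENNReal.ofReal_add (by positivity) hδ,
    ← ENNReal.ofReal_add (by positivity) (by positivity),
    ← ENNReal.ofReal_add (by positivity) (by positivity)]
  refine ENNReal.ofReal_le_ofReal ?_
  -- After cancelling ‖y - f‖², the noise enters as 2K B and the tolerance as δ; dividing by M
  -- leaves at most B + δ because M ≥ 2K and M ≥ 1.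
  rw [hr, div_mul_eq_mul_div, div_le_iff₀ hM0]
  have h4' : 2 * K * (B : ℝ) ≤ M * B := h4
  linarith

/-! ### Integration of the risk bound. -/

theorem ofReal_noiseExcess {n : ℕ} (T : Submodule ℝ (Vec n)) (c : ℝ) (e : Vec n) :
    ENNReal.ofReal (noiseExcess T c e) =
      ENNReal.ofReal (‖T.starProjection e‖ ^ 2 - c * ‖e - T.starProjection e‖ ^ 2) := by
  simp [noiseExcess, ENNReal.ofReal_max]

theorem lintegral_risk_le {n : ℕ} {Ω : Type*} [MeasurableSpace Ω] {μ : Measure Ω}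
    [IsProbabilityMeasure μ] {f : Vec n} {σ : ℝ≥0} {Y : Ω → Vec n}
    (hY : HasLaw Y ((stdGaussian (Vec n)).map fun z => f + (σ : ℝ) • z) μ)
    {Λ : Type*} (fhat : Λ → Ω → Vec n)
    {SS : Set (Submodule ℝ (Vec n))} (hc : SS.Countable)
    (hdim : ∀ S ∈ SS, Module.finrank ℝ S + 2 ≤ n)
    {SSl : Λ → Ω → Set (Submodule ℝ (Vec n))} (hsub : ∀ (l : Λ) (ω : Ω), SSl l ω ⊆ SS)
    {Δ pen : Submodule ℝ (Vec n) → ℝ≥0}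
    (hsum : Summable fun S : SS => Real.exp (-(Δ S : ℝ)))
    {K α δ : ℝ} (hK : 1 < K) (hpen : ∀ S ∈ SS, K * penDelta Δ S ≤ (pen S : ℝ))
    (hα : 0 < α) (hδ : 0 ≤ δ) (lhat : Ω → Λ)
    (hl : ∀ᵐ ω ∂μ, crit α pen (SSl (lhat ω) ω) (Y ω) (fhat (lhat ω) ω) ≤
      (⨅ l : Λ, crit α pen (SSl l ω) (Y ω) (fhat l ω)) + ENNReal.ofReal δ) :
    ENNReal.ofReal (riskConst K α) *
        ∫⁻ ω, ENNReal.ofReal (‖f - fhat (lhat ω) ω‖ ^ 2) ∂μ ≤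
      (∫⁻ ω, ⨅ l : Λ, (ENNReal.ofReal (‖f - fhat l ω‖ ^ 2) +
        accuracy pen (SSl l ω) (Y ω) (fhat l ω)) ∂μ) +
        ENNReal.ofReal ((∑' S : SS, Real.exp (-(Δ S : ℝ))) * (σ : ℝ) ^ 2) +
        ENNReal.ofReal δ := by
  have := hc.to_subtype
  have hex (S : Submodule ℝ (Vec n)) : ∃ T : Submodule ℝ (Vec n), S ∈ SS →
      S ≤ T ∧ f ∈ T ∧ Module.finrank ℝ T = Module.finrank ℝ S + 1 := by
    by_cases hS : S ∈ SS
    · obtain ⟨T, hT⟩ := exists_finrank_succ_containing S f (by have := hdim S hS; omega)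
      exact ⟨T, fun _ => hT⟩
    · exact ⟨⊥, fun h => (hS h).elim⟩
  choose ext hext using hex
  let N : SS → Ω → ℝ≥0∞ := fun S ω => ENNReal.ofReal (noiseExcess (ext S)
    (penDelta Δ S / ((n : ℝ) - Module.finrank ℝ (S : Submodule ℝ (Vec n)))) (Y ω - f))
  have hYm := hY.aemeasurable
  have hN (S : SS) : AEMeasurable (N S) μ := by
    simp only [N, noiseExcess]
    fun_prop
  have hNint (S : SS) : ∫⁻ ω, N S ω ∂μ =
      ENNReal.ofReal (Real.exp (-(Δ S : ℝ)) * (σ : ℝ) ^ 2) := by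
    simp only [N, ofReal_noiseExcess]
    rw [lintegral_excess_eq hY (ext S) (hext S S.2).2.2,
      (penDelta_spec Δ (S : Submodule ℝ (Vec n)) (hdim S S.2)).2]
  have hB : ∫⁻ ω, ∑' S, N S ω ∂μ =
      ENNReal.ofReal ((∑' S : SS, Real.exp (-(Δ S : ℝ))) * (σ : ℝ) ^ 2) := by
    rw [lintegral_tsum hN, ← tsum_mul_right,
      ENNReal.ofReal_tsum_of_nonneg (fun S => by positivity) (hsum.mul_right _)]
    exact tsum_congr hNint
  -- The selected estimator and the infimum over `Λ` need not be measurable. Only a finite constant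
  -- and the measurable noise terms are moved through the integrals.
  rw [← lintegral_const_mul' _ _ ENNReal.ofReal_ne_top, ← hB,
    ← lintegral_add_right' _ (AEMeasurable.tsum hN)]
  have hδc : ENNReal.ofReal δ = ∫⁻ _, ENNReal.ofReal δ ∂μ := by simp
  conv_rhs => rw [hδc]
  rw [← lintegral_add_right' _ aemeasurable_const]
  refine lintegral_mono_ae ?_
  filter_upwards [hl] with ω hω
  refine risk_le_of_crit_le hdim (fun l => hsub l ω)
    (x := penDelta Δ) (fun S hS => (penDelta_spec Δ S (hdim S hS)).1) hK hα hδ hpen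
    (fun S hS => ⟨(hext S hS).1, (hext S hS).2.1⟩) (fun S hS => ?_) (fun l => fhat l ω)
    (lhat ω) hω
  exact ENNReal.le_tsum (⟨S, hS⟩ : SS)

theorem lintegral_iInf_add_le {α ι : Type*} [MeasurableSpace α] {μ : Measure α}
    (F G : ι → α → ℝ≥0∞) (hF : ∀ i, AEMeasurable (F i) μ) :
    ∫⁻ a, ⨅ i, (F i a + G i a) ∂μ ≤ ⨅ i, (∫⁻ a, F i a ∂μ + ∫⁻ a, G i a ∂μ) := by
  refine le_iInf fun i => ?_
  rw [← lintegral_add_left' (hF i)]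
  exact lintegral_mono fun a => iInf_le _ i

/-! The penalty is at most proportional to the complexity. -/

theorem max_zero_le_four_mul_exp (a : ℝ) : max a 0 ≤ 4 * Real.exp (a / 4) := by
  refine max_le ?_ (by positivity)
  have := Real.add_one_le_exp (a / 4)
  linarith

theorem inv_sqrt_half_le : (√(1 + 2 * (-(1 / 4))))⁻¹ ≤ Real.exp (1 / 2) := by
  rw [inv_le_comm₀ (Real.sqrt_pos.2 (by norm_num)) (Real.exp_pos _), ← Real.exp_neg]
  refine Real.le_sqrt_of_sq_le ?_
  rw [← Real.exp_nat_mul, show ((2 : ℕ) : ℝ) * -(1 / 2) = -1 by norm_num, Real.exp_neg,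
    inv_le_comm₀ (Real.exp_pos _) (by norm_num)]
  have := Real.exp_one_gt_d9
  norm_num
  linarith

/-- Exponential Markov bound at parameter 1/4: the expectation factorises by independence, and each
factor of E[exp(U/4)] is √2 ≤ exp(1/2). -/
theorem expectedExcess_le {n d : ℕ} {x : ℝ} (hN : 0 < (n : ℝ) - d) (hx : 0 ≤ x) :
    expectedExcess n d x ≤ 4 * Real.exp (((d : ℝ) + 1) / 2) *
      (√(1 + x / ((n : ℝ) - d) / 2))⁻¹ ^ (n - d - 1) := by
  set q := x / ((n : ℝ) - d)
  have hq : 0 ≤ q := by positivity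
  have h1 := integrable_exp_neg_mul_chiSq (d + 1) (t := -(1 / 4)) (by norm_num)
  have h2 := integrable_exp_neg_mul_chiSq (n - d - 1) (t := q / 4) (by linarith)
  have h3 : expectedExcess n d x ≤ ∫ w : ℝ × ℝ,
      4 * (Real.exp (-(-(1 / 4)) * w.1) * Real.exp (-(q / 4) * w.2))
        ∂((chiSq (d + 1)).prod (chiSq (n - d - 1))) := by
    refine integral_mono (integrable_excess_chiSq _ _) ((h1.mul_prod h2).const_mul 4) fun w => ?_
    refine (max_zero_le_four_mul_exp _).trans_eq ?_
    simp only [← Real.exp_add]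
    congr 2
    ring
  refine h3.trans ?_
  rw [integral_const_mul,
    integral_prod_mul (fun x => Real.exp (-(-(1 / 4)) * x)) (fun x => Real.exp (-(q / 4) * x)),
    integral_exp_neg_mul_chiSq _ (by norm_num), integral_exp_neg_mul_chiSq _ (by linarith),
    ← mul_assoc, show 1 + 2 * (q / 4) = 1 + q / 2 by ring]
  have h4 : Real.exp (((d : ℝ) + 1) / 2) = Real.exp (1 / 2) ^ (d + 1) := by
    rw [← Real.exp_nat_mul]
    push_cast
    ring_nf
  rw [h4]
  gcongr
  exact inv_sqrt_half_le

theorem exp_le_one_add_mul_exp (x : ℝ) : Real.exp x ≤ 1 + x * Real.exp x := by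
  have h := Real.add_one_le_exp (-x)
  have h1 := mul_le_mul_of_nonneg_right h (Real.exp_pos x).le
  rw [← Real.exp_add, neg_add_cancel, Real.exp_zero] at h1
  linarith

/-- The constant 32 exp(16κ/(1 - κ)) is chosen so that the factor coming from V is at most exp(-4D).
This beats 4 exp((d + 1)/2) ≤ 4 exp(D) and leaves 4 exp(-3D) < exp(-D). -/
theorem expectedExcess_lt_exp_neg {n d : ℕ} (hd : d + 2 ≤ n) {κ D x : ℝ} (hκ1 : κ < 1)
    (hD1 : 1 ≤ D) (hdD : (d : ℝ) ≤ D) (hDn : D ≤ κ * n)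
    (hx : 32 * Real.exp (16 * (κ / (1 - κ))) * D ≤ x) :
    expectedExcess n d x < Real.exp (-D) := by
  have hdn : (d : ℝ) + 2 ≤ n := by exact_mod_cast hd
  have hN : 0 < (n : ℝ) - d := by linarith
  set N := (n : ℝ) - d with hNdef
  set ρ := κ / (1 - κ)
  have hκ : 0 < 1 - κ := by linarith
  have hx0 : 0 ≤ x := le_trans (by positivity) hx
  set r := D / N with hr
  have hr0 : 0 ≤ r := by positivity
  -- From d ≤ D ≤ κ n one has n - d ≥ (1 - κ) n.
  have hrρ : r ≤ ρ := by
    rw [hr, div_le_div_iff₀ hN hκ]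
    nlinarith
  have hq : Real.exp (16 * r) ≤ 1 + x / N / 2 := by
    refine (exp_le_one_add_mul_exp _).trans ?_
    have h1 : Real.exp (16 * r) ≤ Real.exp (16 * ρ) := Real.exp_le_exp.2 (by linarith)
    have h2 : 32 * Real.exp (16 * ρ) * r ≤ x / N := by
      rw [hr, ← mul_div_assoc]
      gcongr
    have h3 := mul_le_mul_of_nonneg_left h1 hr0
    linarith
  have hs : (√(1 + x / N / 2))⁻¹ ≤ Real.exp (-(8 * r)) := by
    rw [Real.exp_neg]
    refine inv_anti₀ (Real.exp_pos _) (Real.le_sqrt_of_sq_le ?_)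
    rw [← Real.exp_nat_mul]
    refine le_trans (le_of_eq ?_) hq
    congr 1
    push_cast
    ring
  have hpow : (√(1 + x / N / 2))⁻¹ ^ (n - d - 1) ≤ Real.exp (-(4 * D)) := by
    refine (pow_le_pow_left₀ (by positivity) hs _).trans ?_
    rw [← Real.exp_nat_mul, Real.exp_le_exp]
    -- As N ≥ 2, the exponent N - 1 is at least N / 2; this halves 8 r N = 8 D to 4 D.
    have hk : ((n - d - 1 : ℕ) : ℝ) = N - 1 := by
      rw [Nat.sub_sub, Nat.cast_sub (by omega), hNdef]
      push_cast
      ring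
    have hDr : D = r * N := by rw [hr]; field_simp
    rw [hk]
    nlinarith
  calc expectedExcess n d x ≤ _ := expectedExcess_le hN hx0
    _ ≤ 4 * Real.exp D * Real.exp (-(4 * D)) := by
        gcongr
        linarith
    _ = 4 * (Real.exp (-(2 * D)) * Real.exp (-D)) := by
        rw [mul_assoc, ← Real.exp_add, ← Real.exp_add]
        ring_nf
    _ < Real.exp (-D) := by
        have h1 : Real.exp (-(2 * D)) ≤ Real.exp (-2) := Real.exp_le_exp.2 (by linarith)
        have h2 : 4 < Real.exp 2 := by
          have := Real.exp_one_gt_d9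
          rw [show (2 : ℝ) = 1 + 1 by norm_num, Real.exp_add]
          nlinarith
        have h3 : Real.exp (-2) * Real.exp 2 = 1 := by
          rw [← Real.exp_add]
          simp
        have h4 : Real.exp (-(2 * D)) < 1 / 4 := by
          have := Real.exp_pos (-2)
          nlinarith
        have := Real.exp_pos (-D)
        nlinarith

theorem penDelta_le {n : ℕ} {Δ : Submodule ℝ (Vec n) → ℝ≥0} {S : Submodule ℝ (Vec n)}
    (hS : Module.finrank ℝ S + 2 ≤ n) {κ : ℝ} (hκ1 : κ < 1)
    (hD1 : 1 ≤ complexity Δ S) (hDn : complexity Δ S ≤ κ * n) :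
    penDelta Δ S ≤ 32 * Real.exp (16 * (κ / (1 - κ))) * complexity Δ S := by
  by_contra! h
  have h1 := expectedExcess_lt_exp_neg hS hκ1 hD1 (le_max_left _ _) hDn h.le
  rw [(penDelta_spec Δ S hS).2, Real.exp_lt_exp] at h1
  have : (Δ S : ℝ) ≤ complexity Δ S := le_max_right _ _
  linarith

/-! ### Bounds on the accuracy index. -/

/-- The centring 2n makes the exponential bound uniform in n: the factor exp(-n/2) offsets
E[exp(W/4)] = 2^(n/2) ≤ exp(n/2). -/
theorem lintegral_ofReal_sub_chiSq_le (n : ℕ) :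
    ∫⁻ w, ENNReal.ofReal (w - 2 * n) ∂(chiSq n) ≤ ENNReal.ofReal 4 := by
  have h1 := integrable_exp_neg_mul_chiSq n (t := -(1 / 4)) (by norm_num)
  calc ∫⁻ w, ENNReal.ofReal (w - 2 * n) ∂(chiSq n)
      ≤ ∫⁻ w, ENNReal.ofReal (4 * Real.exp (-(n / 2)) * Real.exp (-(-(1 / 4)) * w)) ∂(chiSq n) := by
        refine lintegral_mono fun w => ENNReal.ofReal_le_ofReal ?_
        refine ((le_max_left _ 0).trans (max_zero_le_four_mul_exp _)).trans_eq ?_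
        rw [mul_assoc, ← Real.exp_add]
        congr 2
        ring
    _ = ENNReal.ofReal (4 * Real.exp (-(n / 2)) * (√(1 + 2 * (-(1 / 4))))⁻¹ ^ n) := by
        rw [← ofReal_integral_eq_lintegral_ofReal (h1.const_mul _)
          (Eventually.of_forall fun w => by positivity), integral_const_mul,
          integral_exp_neg_mul_chiSq n (by norm_num)]
    _ ≤ ENNReal.ofReal 4 := by
        refine ENNReal.ofReal_le_ofReal ?_
        have h2 : (√(1 + 2 * (-(1 / 4))))⁻¹ ^ n ≤ Real.exp (n / 2) := by
          refine (pow_le_pow_left₀ (by positivity) inv_sqrt_half_le n).trans_eq ?_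
          rw [← Real.exp_nat_mul]
          ring_nf
        calc 4 * Real.exp (-(n / 2)) * (√(1 + 2 * (-(1 / 4))))⁻¹ ^ n
            ≤ 4 * Real.exp (-(n / 2)) * Real.exp (n / 2) := by gcongr
          _ = 4 := by rw [mul_assoc, ← Real.exp_add]; simp

theorem lintegral_norm_sq_noise_excess_le {n : ℕ} {Ω : Type*} [MeasurableSpace Ω] {μ : Measure Ω}
    {f : Vec n} {σ : ℝ≥0} {Y : Ω → Vec n}
    (hY : HasLaw Y ((stdGaussian (Vec n)).map fun z => f + (σ : ℝ) • z) μ) :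
    ∫⁻ ω, ENNReal.ofReal (‖Y ω - f‖ ^ 2 - 2 * n * (σ : ℝ) ^ 2) ∂μ ≤
      ENNReal.ofReal ((σ : ℝ) ^ 2) * ENNReal.ofReal 4 := by
  rw [hY.lintegral_comp (f := fun y => ENNReal.ofReal (‖y - f‖ ^ 2 - 2 * n * (σ : ℝ) ^ 2))
        (Measurable.aemeasurable (by fun_prop)),
    lintegral_map (by fun_prop) (by fun_prop)]
  have h1 (z : Vec n) : ENNReal.ofReal (‖f + (σ : ℝ) • z - f‖ ^ 2 - 2 * n * (σ : ℝ) ^ 2) =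
      ENNReal.ofReal ((σ : ℝ) ^ 2) * (fun w : ℝ => ENNReal.ofReal (w - 2 * n)) (‖z‖ ^ 2) := by
    simp only [add_sub_cancel_left, norm_smul, ← ENNReal.ofReal_mul (sq_nonneg (σ : ℝ))]
    congr 1
    simp only [Real.norm_eq_abs, mul_pow, sq_abs]
    ring
  simp only [h1]
  rw [lintegral_const_mul _ (by fun_prop), ← lintegral_map (f := fun w : ℝ => ENNReal.ofReal
    (w - 2 * n)) (g := fun z => ‖z‖ ^ 2) (by fun_prop) (by fun_prop), map_norm_sq_stdGaussian]
  gcongr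
  exact lintegral_ofReal_sub_chiSq_le n

/-- The inverse of the constant of the bounds on the accuracy index. -/
noncomputable def accuracyConst (K κ : ℝ) : ℝ :=
  1 + 3 * (K * (32 * Real.exp (16 * (κ / (1 - κ)))) * (κ / (1 - κ))) +
    18 * (K * (32 * Real.exp (16 * (κ / (1 - κ)))) / (1 - κ))

theorem accuracyConst_pos {K κ : ℝ} (hK : 0 < K) (hκ : 0 < κ) (hκ1 : κ < 1) :
    0 < accuracyConst K κ := by
  have : 0 < 1 - κ := by linarith
  unfold accuracyConst
  positivity

/-- The ratio q = p / (n - dim S) is bounded in two ways: by a constant P, used against ‖f - g‖² and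
‖g - Π_S g‖², and by Q D / n, whose 1/n compensates ‖y - f‖² ≈ n s. The weights 1/6 and 1/3 are such
that, after integration, 4/6 + D/3 ≤ D when D ≥ 1. -/
theorem accuracy_term_le {n : ℕ} {Δ : Submodule ℝ (Vec n) → ℝ≥0} {S : Submodule ℝ (Vec n)}
    (hS : Module.finrank ℝ S + 2 ≤ n) {K κ p s : ℝ} (hK : 0 < K) (hκ : 0 < κ) (hκ1 : κ < 1)
    (hs : 0 ≤ s) (hp : p = K * penDelta Δ S) (hD1 : 1 ≤ complexity Δ S) (hDn : complexity Δ S ≤ κ * n)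
    (f y g : Vec n) :
    (accuracyConst K κ)⁻¹ * (‖g - S.starProjection g‖ ^ 2 + p * sigmaHatSq S y) ≤
      ‖f - g‖ ^ 2 + ‖g - S.starProjection g‖ ^ 2 + 1 / 6 * max (‖y - f‖ ^ 2 - 2 * n * s) 0 +
        1 / 3 * (complexity Δ S * s) := by
  have hdn : (Module.finrank ℝ S : ℝ) + 2 ≤ n := by exact_mod_cast hS
  have hpen := penDelta_le hS hκ1 hD1 hDn
  have hpen0 := (penDelta_spec Δ S hS).1
  have hc0 : 0 < 1 - κ := by linarith
  have hdD : (Module.finrank ℝ S : ℝ) ≤ complexity Δ S := le_max_left _ _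
  set D := complexity Δ S
  set d : ℝ := (Module.finrank ℝ S : ℝ)
  have hd0 : 0 ≤ d := by positivity
  have hN : 0 < (n : ℝ) - d := by linarith
  have hn : (0 : ℝ) < n := by linarith
  unfold accuracyConst
  set c := 32 * Real.exp (16 * (κ / (1 - κ)))
  have hc : 0 < c := by positivity
  set P := K * c * (κ / (1 - κ))
  set Q := K * c / (1 - κ) with hQ
  have hP : P = κ * Q := by ring
  have hQ0 : 0 < Q := by positivity
  have hP0 : 0 < P := by positivity
  have hratio : p / ((n : ℝ) - d) ≤ Q * (D / n) := by
    rw [hp, hQ, div_mul_div_comm]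
    apply div_le_div₀ (by positivity)
    · rw [mul_assoc]; gcongr
    · positivity
    · nlinarith
  have hDnκ : D / n ≤ κ := by rwa [div_le_iff₀ hn]
  have hDn0 : 0 ≤ D / n := by positivity
  have hp0 : 0 ≤ p := by rw [hp]; positivity
  have hr0 : 0 ≤ p / ((n : ℝ) - d) := by positivity
  set q := p / ((n : ℝ) - d)
  have hqP : q ≤ P := hratio.trans (by rw [hP, mul_comm κ]; gcongr)
  set a := ‖g - S.starProjection g‖
  set b := ‖f - g‖
  set e := ‖y - f‖
  have h1 : ‖y - S.starProjection y‖ ^ 2 ≤ 3 * (e ^ 2 + b ^ 2 + a ^ 2) := by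
    have h2 : ‖y - S.starProjection y‖ ≤ e + b + a := by
      refine (norm_sub_starProjection_le S y (S.starProjection_apply_mem g)).trans ?_
      have := norm_add₃_le (a := y - f) (b := f - g) (c := g - S.starProjection g)
      rwa [sub_add_sub_cancel, sub_add_sub_cancel] at this
    refine (pow_le_pow_left₀ (norm_nonneg _) h2 2).trans ?_
    nlinarith [sq_nonneg (e - b), sq_nonneg (e - a), sq_nonneg (b - a)]
  have h2 : p * sigmaHatSq S y ≤ q * (3 * (e ^ 2 + b ^ 2 + a ^ 2)) := by
    have : p * sigmaHatSq S y = q * ‖y - S.starProjection y‖ ^ 2 := by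
      unfold sigmaHatSq
      ring
    rw [this]
    gcongr
  set W := max (e ^ 2 - 2 * n * s) 0
  have hW0 : 0 ≤ W := le_max_right _ _
  have hW : e ^ 2 ≤ W + 2 * n * s := by
    have : e ^ 2 - 2 * n * s ≤ W := le_max_left _ _
    linarith
  have h3 : q * e ^ 2 ≤ Q * (W + 2 * (D * s)) := by
    calc q * e ^ 2 ≤ Q * (D / n) * e ^ 2 := by gcongr
      _ ≤ Q * (D / n) * (W + 2 * n * s) := by gcongr
      _ = Q * (D / n * W + 2 * (D * s)) := by field_simp
      _ ≤ Q * (W + 2 * (D * s)) := by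
        gcongr
        exact mul_le_of_le_one_left hW0 (hDnκ.trans hκ1.le)
  have h4 : q * (b ^ 2 + a ^ 2) ≤ P * (b ^ 2 + a ^ 2) := by gcongr
  rw [inv_mul_le_iff₀ (by positivity)]
  -- These are the terms of the expanded product that are not needed; the needed noise term is 3 Q
  -- (W + 2 D s) = 18 Q (W / 6 + D s / 3).
  have h5 : 0 ≤ (1 + 3 * P) * (1 / 6 * W + 1 / 3 * (D * s)) + b ^ 2 + 18 * Q * (a ^ 2 + b ^ 2) := by
    positivity
  linarith

/-- Integrated form of the bound on the accuracy index, for a possibly random linear space. -/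
theorem lintegral_accuracy_le {n : ℕ} {Ω : Type*} [MeasurableSpace Ω] {μ : Measure Ω}
    {f : Vec n} {σ : ℝ≥0} {Y : Ω → Vec n}
    (hY : HasLaw Y ((stdGaussian (Vec n)).map fun z => f + (σ : ℝ) • z) μ)
    {g : Ω → Vec n} (hg : AEMeasurable g μ)
    {SS : Set (Submodule ℝ (Vec n))} (hdim : ∀ S ∈ SS, Module.finrank ℝ S + 2 ≤ n)
    {T : Ω → Set (Submodule ℝ (Vec n))} (hT : ∀ ω, T ω ⊆ SS)
    {Δ pen : Submodule ℝ (Vec n) → ℝ≥0} {K κ : ℝ} (hK : 0 < K)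
    (hpen : ∀ S ∈ SS, (pen S : ℝ) = K * penDelta Δ S) (hκ : 0 < κ) (hκ1 : κ < 1)
    (hD : ∀ S ∈ SS, 1 ≤ complexity Δ S ∧ complexity Δ S ≤ κ * n)
    {Shat : Ω → Submodule ℝ (Vec n)} (hShat : ∀ᵐ ω ∂μ, Shat ω ∈ T ω) :
    ENNReal.ofReal (accuracyConst K κ)⁻¹ * ∫⁻ ω, accuracy pen (T ω) (Y ω) (g ω) ∂μ ≤
      (∫⁻ ω, ENNReal.ofReal (‖f - g ω‖ ^ 2) ∂μ) + ENNReal.ofReal (2 / 3 * (σ : ℝ) ^ 2) +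
        ∫⁻ ω, (ENNReal.ofReal (‖g ω - (Shat ω).starProjection (g ω)‖ ^ 2) +
          ENNReal.ofReal (1 / 3 * (complexity Δ (Shat ω) * (σ : ℝ) ^ 2))) ∂μ := by
  have hYm := hY.aemeasurable
  have hW : ∫⁻ ω, ENNReal.ofReal (1 / 6) *
      ENNReal.ofReal (‖Y ω - f‖ ^ 2 - 2 * n * (σ : ℝ) ^ 2) ∂μ ≤
      ENNReal.ofReal (2 / 3 * (σ : ℝ) ^ 2) := by
    rw [lintegral_const_mul' _ _ ENNReal.ofReal_ne_top]
    calc _ ≤ ENNReal.ofReal (1 / 6) * (ENNReal.ofReal ((σ : ℝ) ^ 2) * ENNReal.ofReal 4) := by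
          gcongr
          exact lintegral_norm_sq_noise_excess_le hY
      _ = _ := by
          rw [← ENNReal.ofReal_mul (by positivity), ← ENNReal.ofReal_mul (by norm_num)]
          congr 1
          ring
  have hc := accuracyConst_pos hK hκ hκ1
  calc _ ≤ ∫⁻ ω, ((ENNReal.ofReal (‖f - g ω‖ ^ 2) + ENNReal.ofReal (1 / 6) *
            ENNReal.ofReal (‖Y ω - f‖ ^ 2 - 2 * n * (σ : ℝ) ^ 2)) +
          (ENNReal.ofReal (‖g ω - (Shat ω).starProjection (g ω)‖ ^ 2) +
            ENNReal.ofReal (1 / 3 * (complexity Δ (Shat ω) * (σ : ℝ) ^ 2)))) ∂μ := by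
        rw [← lintegral_const_mul' _ _ ENNReal.ofReal_ne_top]
        refine lintegral_mono_ae ?_
        filter_upwards [hShat] with ω hω
        have hS := hT ω hω
        have hDS := (hD _ hS).1
        have h1 := accuracy_term_le (hdim _ hS) hK hκ hκ1 (sq_nonneg (σ : ℝ)) (hpen _ hS)
          hDS (hD _ hS).2 f (Y ω) (g ω)
        have h2 : accuracy pen (T ω) (Y ω) (g ω) ≤ _ := iInf₂_le (Shat ω) hω
        have hpos (a : ℝ) : ENNReal.ofReal a = ENNReal.ofReal (max a 0) := by
          simp [ENNReal.ofReal_max]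
        refine (mul_le_mul_right h2 _).trans ?_
        rw [← ENNReal.ofReal_mul (by positivity), hpos (‖Y ω - f‖ ^ 2 - 2 * n * (σ : ℝ) ^ 2),
          ← ENNReal.ofReal_mul (by positivity), ← ENNReal.ofReal_add (by positivity) (by positivity),
          ← ENNReal.ofReal_add (by positivity) (by positivity),
          ← ENNReal.ofReal_add (by positivity) (by positivity)]
        refine ENNReal.ofReal_le_ofReal ?_
        linarith
    _ ≤ _ := by
        -- Each splitting asks measurability of the left summand only, so the terms in the random
        -- space `Shat` may be non-measurable.
        rw [lintegral_add_left' (by fun_prop), lintegral_add_left' (by fun_prop)]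
        gcongr

theorem lintegral_accuracy_le_of_const {n : ℕ} {Ω : Type*} [MeasurableSpace Ω] {μ : Measure Ω}
    [IsProbabilityMeasure μ] {f : Vec n} {σ : ℝ≥0} {Y : Ω → Vec n}
    (hY : HasLaw Y ((stdGaussian (Vec n)).map fun z => f + (σ : ℝ) • z) μ)
    {g : Ω → Vec n} (hg : AEMeasurable g μ)
    {SS : Set (Submodule ℝ (Vec n))} (hdim : ∀ S ∈ SS, Module.finrank ℝ S + 2 ≤ n)
    {T : Ω → Set (Submodule ℝ (Vec n))} (hT : ∀ ω, T ω ⊆ SS)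
    {Δ pen : Submodule ℝ (Vec n) → ℝ≥0} {K κ : ℝ} (hK : 0 < K)
    (hpen : ∀ S ∈ SS, (pen S : ℝ) = K * penDelta Δ S) (hκ : 0 < κ) (hκ1 : κ < 1)
    (hD : ∀ S ∈ SS, 1 ≤ complexity Δ S ∧ complexity Δ S ≤ κ * n)
    {T₀ : Set (Submodule ℝ (Vec n))} (hT₀ : ∀ᵐ ω ∂μ, T ω = T₀) :
    ENNReal.ofReal (accuracyConst K κ)⁻¹ * ∫⁻ ω, accuracy pen (T ω) (Y ω) (g ω) ∂μ ≤
      (∫⁻ ω, ENNReal.ofReal (‖f - g ω‖ ^ 2) ∂μ) +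
        ⨅ S ∈ T₀, ((∫⁻ ω, ENNReal.ofReal (‖g ω - S.starProjection (g ω)‖ ^ 2) ∂μ) +
          ENNReal.ofReal (complexity Δ S * (σ : ℝ) ^ 2)) := by
  simp only [ENNReal.add_iInf]
  refine le_iInf₂ fun S hS => ?_
  -- A probability measure has a point in every almost sure event; it transfers the inclusion in
  -- `SS` to the deterministic family.
  obtain ⟨ω₀, hω₀⟩ := hT₀.exists
  have hSS : S ∈ SS := hT ω₀ (hω₀ ▸ hS)
  have h := lintegral_accuracy_le hY hg hdim hT hK hpen hκ hκ1 hD (Shat := fun _ => S)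
    (by filter_upwards [hT₀] with ω hω; rwa [hω])
  refine h.trans ?_
  rw [lintegral_add_left' (by fun_prop), lintegral_const, measure_univ, mul_one, add_assoc,
    add_left_comm (ENNReal.ofReal (2 / 3 * (σ : ℝ) ^ 2))]
  have hD1 := (hD S hSS).1
  rw [← ENNReal.ofReal_add (by positivity) (by positivity)]
  gcongr
  nlinarith [mul_le_mul_of_nonneg_right hD1 (sq_nonneg (σ : ℝ))]

theorem lintegral_accuracy_le_of_mem {n : ℕ} {Ω : Type*} [MeasurableSpace Ω] {μ : Measure Ω}
    [IsProbabilityMeasure μ] {f : Vec n} {σ : ℝ≥0} {Y : Ω → Vec n}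
    (hY : HasLaw Y ((stdGaussian (Vec n)).map fun z => f + (σ : ℝ) • z) μ)
    {g : Ω → Vec n} (hg : AEMeasurable g μ)
    {SS : Set (Submodule ℝ (Vec n))} (hdim : ∀ S ∈ SS, Module.finrank ℝ S + 2 ≤ n)
    {T : Ω → Set (Submodule ℝ (Vec n))} (hT : ∀ ω, T ω ⊆ SS)
    {Δ pen : Submodule ℝ (Vec n) → ℝ≥0} {K κ : ℝ} (hK : 0 < K)
    (hpen : ∀ S ∈ SS, (pen S : ℝ) = K * penDelta Δ S) (hκ : 0 < κ) (hκ1 : κ < 1)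
    (hD : ∀ S ∈ SS, 1 ≤ complexity Δ S ∧ complexity Δ S ≤ κ * n)
    {Shat : Ω → Submodule ℝ (Vec n)} (hShat : ∀ᵐ ω ∂μ, Shat ω ∈ T ω ∧ g ω ∈ Shat ω) :
    ENNReal.ofReal (accuracyConst K κ)⁻¹ * ∫⁻ ω, accuracy pen (T ω) (Y ω) (g ω) ∂μ ≤
      (∫⁻ ω, ENNReal.ofReal (‖f - g ω‖ ^ 2) ∂μ) +
        (∫⁻ ω, ENNReal.ofReal (complexity Δ (Shat ω)) ∂μ) * ENNReal.ofReal ((σ : ℝ) ^ 2) := by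
  have h := lintegral_accuracy_le hY hg hdim hT hK hpen hκ hκ1 hD (hShat.mono fun _ h => h.1)
  refine h.trans ?_
  rw [add_assoc]
  gcongr
  set I := ∫⁻ ω, ENNReal.ofReal (complexity Δ (Shat ω)) ∂μ with hI
  -- Complexities are at least 1, so the remainder 2σ²/3 is absorbed as 2σ² I / 3.
  have hI1 : 1 ≤ I := by
    calc (1 : ℝ≥0∞) = ∫⁻ _, 1 ∂μ := by simp
      _ ≤ I := by
        refine lintegral_mono_ae ?_
        filter_upwards [hShat] with ω hω
        exact ENNReal.one_le_ofReal.2 (hD _ (hT ω hω.1)).1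
  have h2 : ∫⁻ ω, (ENNReal.ofReal (‖g ω - (Shat ω).starProjection (g ω)‖ ^ 2) +
      ENNReal.ofReal (1 / 3 * (complexity Δ (Shat ω) * (σ : ℝ) ^ 2))) ∂μ ≤
      ENNReal.ofReal (1 / 3 * (σ : ℝ) ^ 2) * I := by
    rw [hI, ← lintegral_const_mul' _ _ ENNReal.ofReal_ne_top]
    refine lintegral_mono_ae ?_
    filter_upwards [hShat] with ω hω
    rw [Submodule.starProjection_eq_self_iff.2 hω.2, sub_self, norm_zero,
      ← ENNReal.ofReal_mul (by positivity)]
    simp only [ne_eq, OfNat.ofNat_ne_zero, not_false_eq_true, zero_pow, ENNReal.ofReal_zero,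
      zero_add]
    refine ENNReal.ofReal_le_ofReal (le_of_eq ?_)
    ring
  calc _ ≤ ENNReal.ofReal (2 / 3 * (σ : ℝ) ^ 2) * I + ENNReal.ofReal (1 / 3 * (σ : ℝ) ^ 2) * I :=
        add_le_add (le_mul_of_one_le_right' hI1) h2
    _ = I * ENNReal.ofReal ((σ : ℝ) ^ 2) := by
        rw [← add_mul, ← ENNReal.ofReal_add (by positivity) (by positivity), mul_comm]
        congr 2
        ring

end EstimatorSelection

theorem theorem1 (K : ℝ) (hK : 1 < K) :
    (∀ α : ℝ, 0 < α → 0 < riskConst K α) ∧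
    ∃ C' : ℝ → ℝ, (∀ κ : ℝ, 0 < κ → κ < 1 → 0 < C' κ) ∧
      ∀ (n : ℕ) (Ω : Type*) [MeasurableSpace Ω] (μ : Measure Ω) [IsProbabilityMeasure μ]
        -- the observation: independent Gaussian coordinates with means `f i` and variance `σ ^ 2`
        (f : Vec n) (σ : ℝ≥0) (Y : Ω → Vec n)
        (_ : iIndepFun (fun (i : Fin n) (ω : Ω) => Y ω i) μ)
        (_ : ∀ i : Fin n, HasLaw (fun ω : Ω => Y ω i) (gaussianReal (f i) (σ ^ 2)) μ)
        -- the estimators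
        (Λ : Type*) (fhat : Λ → Ω → Vec n)
        (_ : ∀ l : Λ, AEMeasurable (fhat l) μ)
        -- the family of linear spaces, its (possibly random) subfamilies, weights and penalty
        (SS : Set (Submodule ℝ (Vec n))) (_ : SS.Countable)
        (_ : ∀ S ∈ SS, Module.finrank ℝ S + 2 ≤ n)
        (SSl : Λ → Ω → Set (Submodule ℝ (Vec n)))
        (_ : ∀ (l : Λ) (ω : Ω), SSl l ω ⊆ SS)
        (Δ pen : Submodule ℝ (Vec n) → ℝ≥0)
        (_ : Summable fun S : SS => Real.exp (-(Δ S : ℝ)))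
        (_ : ∀ S ∈ SS, K * penDelta Δ S ≤ (pen S : ℝ)),
        -- the risk bound
        (∀ (α : ℝ) (_ : 0 < α) (δ : ℝ) (_ : 0 ≤ δ) (lhat : Ω → Λ)
          (_ : ∀ᵐ ω ∂μ,
            crit α pen (SSl (lhat ω) ω) (Y ω) (fhat (lhat ω) ω) ≤
              (⨅ l : Λ, crit α pen (SSl l ω) (Y ω) (fhat l ω)) + ENNReal.ofReal δ),
          ENNReal.ofReal (riskConst K α) *
              ∫⁻ ω, ENNReal.ofReal (‖f - fhat (lhat ω) ω‖ ^ 2) ∂μ ≤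
            (∫⁻ ω, ⨅ l : Λ, (ENNReal.ofReal (‖f - fhat l ω‖ ^ 2) +
              accuracy pen (SSl l ω) (Y ω) (fhat l ω)) ∂μ) +
              ENNReal.ofReal ((∑' S : SS, Real.exp (-(Δ S : ℝ))) * (σ : ℝ) ^ 2) +
              ENNReal.ofReal δ ∧
          (∫⁻ ω, ⨅ l : Λ, (ENNReal.ofReal (‖f - fhat l ω‖ ^ 2) +
              accuracy pen (SSl l ω) (Y ω) (fhat l ω)) ∂μ) +
              ENNReal.ofReal ((∑' S : SS, Real.exp (-(Δ S : ℝ))) * (σ : ℝ) ^ 2) +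
              ENNReal.ofReal δ ≤
            (⨅ l : Λ, ((∫⁻ ω, ENNReal.ofReal (‖f - fhat l ω‖ ^ 2) ∂μ) +
              ∫⁻ ω, accuracy pen (SSl l ω) (Y ω) (fhat l ω) ∂μ)) +
              ENNReal.ofReal ((∑' S : SS, Real.exp (-(Δ S : ℝ))) * (σ : ℝ) ^ 2) +
              ENNReal.ofReal δ) ∧
        -- the bounds on the accuracy index
        ((∀ S ∈ SS, (pen S : ℝ) = K * penDelta Δ S) →
          ∀ κ : ℝ, 0 < κ → κ < 1 →
          (∀ S ∈ SS, 1 ≤ complexity Δ S ∧ complexity Δ S ≤ κ * n) →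
          ∀ l : Λ,
            (∀ T : Set (Submodule ℝ (Vec n)), (∀ᵐ ω ∂μ, SSl l ω = T) →
              ENNReal.ofReal (C' κ) *
                  ∫⁻ ω, accuracy pen (SSl l ω) (Y ω) (fhat l ω) ∂μ ≤
                (∫⁻ ω, ENNReal.ofReal (‖f - fhat l ω‖ ^ 2) ∂μ) +
                ⨅ S ∈ T,
                  ((∫⁻ ω, ENNReal.ofReal (‖fhat l ω - S.starProjection (fhat l ω)‖ ^ 2) ∂μ) +
                    ENNReal.ofReal (complexity Δ S * (σ : ℝ) ^ 2))) ∧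
            (∀ Shat : Ω → Submodule ℝ (Vec n),
              (∀ᵐ ω ∂μ, Shat ω ∈ SSl l ω ∧ fhat l ω ∈ Shat ω) →
              ENNReal.ofReal (C' κ) *
                  ∫⁻ ω, accuracy pen (SSl l ω) (Y ω) (fhat l ω) ∂μ ≤
                (∫⁻ ω, ENNReal.ofReal (‖f - fhat l ω‖ ^ 2) ∂μ) +
                (∫⁻ ω, ENNReal.ofReal (complexity Δ (Shat ω)) ∂μ) *
                  ENNReal.ofReal ((σ : ℝ) ^ 2))) := by
  refine ⟨fun α hα => riskConst_pos hK hα, fun κ => (accuracyConst K κ)⁻¹,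
    fun κ hκ hκ1 => inv_pos.2 (accuracyConst_pos (by linarith) hκ hκ1), ?_⟩
  intro n Ω _ μ _ f σ Y hind hlaw Λ fhat hfhat SS hc hdim SSl hsub Δ pen hsum hpen
  have hY := hasLaw_of_iIndepFun_gaussianReal hind hlaw
  refine ⟨fun α hα δ hδ lhat hl =>
    ⟨lintegral_risk_le hY fhat hc hdim hsub hsum hK hpen hα hδ lhat hl, ?_⟩,
    fun hpeneq κ hκ hκ1 hD l => ⟨fun T hT => ?_, fun Shat hShat => ?_⟩⟩
  · gcongr
    exact lintegral_iInf_add_le _ _ fun l => by have := hfhat l; fun_prop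
  · exact lintegral_accuracy_le_of_const hY (hfhat l) hdim (hsub l) (by linarith) hpeneq hκ hκ1
      hD hT
  · exact lintegral_accuracy_le_of_mem hY (hfhat l) hdim (hsub l) (by linarith) hpeneq hκ hκ1
      hD hShat
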